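/- Let $n\ge b\ge 2$ and $D\ge 1$ be integers, write $[q]=\{0,1,\dots,q-1\}$, and for a vector $\mathbf x=(x_0,\dots,x_{d-1})$ of integers put $[\mathbf x]_q=\sum_{t=0}^{d-1}x_tq^t$. Let $p$ be the smallest prime with $p\ge 2b+1$ and let $s=\lceil\log_p(D+1)\rceil$. Let $\xi_0,\dots,\xi_{D-1}\in\mathbb F_{p^s}$ be distinct and let $$C_L=\Big\{\mathbf c\in\mathbb F_p^D : \sum_{t=0}^{D-1}c_t\,\xi_t^{\,j}=0\ \text{ for all } 0\le j\le b-1\Big\}$$ (with $\xi^0=1$) be the corresponding BCH code over $\mathbb F_p$. Let $r=D-\dim C_L$, and let $A$ be an $r\times D$ matrix over $\mathbb F_p$ whose kernel is $C_L$. Define $$m=\lceil\log_2(n^D+1)\rceil,\qquad a=\lceil\log_2(p^{r}+1)\rceil,\qquad a'=\lceil\log_2(p^D+1)\rceil,$$ assume $\gcd(p,2^m-1)=1$, and let $\alpha\in\mathbb F_{2^m}$, $\beta\in\mathbb F_{2^a}$, $\gamma\in\mathbb F_{2^{a'}}$ be primitive elements (generators of the multiplicative groups). Let $H$ be the binary matrix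 whose columns are indexed by $\mathbf i\in[np]^D$ and whose $\mathbf i$-th column is $$\mathbf h_{\mathbf i}^\intercal=\begin{pmatrix}\beta^{[A\mathbf i^\intercal \bmod p]_p}\\ \beta^{3[A\mathbf i^\intercal \bmod p]_p}\\ \lfloor \mathbf i^\intercal/p\rfloor \bmod 2\\ \gamma^{[\mathbf i\bmod p]_p}\\ \alpha^{[\mathbf i]_n}\end{pmatrix},$$ where $\lfloor\cdot/p\rfloor$ and $\bmod$ act entrywise and each element of $\mathbb F_{2^k}$ is written as $k$ binary entries by means of an $\mathbb F_2$-linear isomorphism $\mathbb F_{2^k}\cong\mathbb F_2^k$ (fixed for each of the three fields). Let $C=\ker H$. Then $C$ is a binary linear $D$-dimensional code of length $(np)^{\times D}$, that is, an $[N,k]$ code with $N=(np)^D$ and some dimension $k$, and it is capable of correcting a single $2$-weight-limited $b$-burst in the $L_1$ model. Namely, let $E$ be the set of all $\mathbf e\in\mathbb F_2^{[np]^D}$ that either have Hamming weight at most $1$, or have Hamming weight $2$ with the two nonzero positions $\mathbf i\ne\mathbf j$ satisfying $\sum_{t=0}^{D-1}|i_t-j_t|<b$. Then there is a decoding map $\mathrm{dec}:\mathbb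 F_2^{[np]^D}\to\mathbb F_2^{[np]^D}$ such that $\mathrm{dec}(\mathbf c+\mathbf e)=\mathbf c$ for all $\mathbf c\in C$ and $\mathbf e\in E$. -/

import Mathlib

namespace BurstCode

/-- Positions of a `D`-dimensional array of side `N`. -/
abbrev Pos (N D : ℕ) : Type := Fin D → Fin N

/-- Binary `D`-dimensional arrays of side `N`. -/
abbrev Arr (N D : ℕ) : Type := Pos N D → ZMod 2

/-- Two positions are `b`-close in the `L₁` model. -/
def IsCloseL1 {N D : ℕ} (b : ℕ) (i j : Pos N D) : Prop :=
  ∑ t, |((i t : ℕ) : ℤ) - ((j t : ℕ) : ℤ)| < (b : ℤ)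

/-- The `2`-weight-limited `b`-bursts in the `L₁` model. -/
def burstsL1 (N D b : ℕ) : Set (Arr N D) :=
  {e | hammingNorm e ≤ 1 ∨
    (hammingNorm e = 2 ∧ ∃ i j, i ≠ j ∧ e i = 1 ∧ e j = 1 ∧ IsCloseL1 b i j)}

/-- `C` corrects the error patterns in `E`: some decoder recovers every codeword `c` from
`c + e`, for every error pattern `e` in `E`. -/
def Corrects {ι : Type*} (C : Submodule (ZMod 2) (ι → ZMod 2)) (E : Set (ι → ZMod 2)) : Prop :=
  ∃ dec : (ι → ZMod 2) → (ι → ZMod 2), ∀ c ∈ C, ∀ e ∈ E, dec (c + e) = c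

/-- `C` is an `[N, k]` linear code. -/
def HasParameters {F ι : Type*} [Field F] [Fintype ι] (C : Submodule F (ι → F)) (N k : ℕ) :
    Prop :=
  Fintype.card ι = N ∧ Module.finrank F C = k

/-- The redundancy: length minus dimension. -/
noncomputable def redundancy {F ι : Type*} [Field F] [Fintype ι] (C : Submodule F (ι → F)) : ℕ :=
  Fintype.card ι - Module.finrank F C

/-- The linear code whose parity-check matrix is `H`, i.e. the kernel of `H`. -/
def codeOf {F κ ι : Type*} [Field F] [Fintype ι] (H : Matrix κ ι F) : Submodule F (ι → F) :=
  LinearMap.ker H.mulVecLin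

/-- A primitive element of a field: a generator of its multiplicative group. -/
def IsPrimitiveElement {K : Type*} [Field K] (x : K) : Prop :=
  ∃ u : Kˣ, (u : K) = x ∧ ∀ v : Kˣ, v ∈ Subgroup.zpowers u

/-- `[x]_q = ∑ t, x_t q ^ t`. -/
def baseVal {D : ℕ} (q : ℕ) (x : Fin D → ℕ) : ℕ := ∑ t, x t * q ^ (t : ℕ)

/-- The matrix over `K` with rows `1, ξ, ξ², …, ξ^(b-1)` (entrywise powers). -/
def bchMatrix {K : Type*} [Field K] {D : ℕ} (b : ℕ) (ξ : Fin D → K) : Matrix (Fin b) (Fin D) K :=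
  Matrix.of fun j t => ξ t ^ (j : ℕ)

/-- The BCH code over `𝔽_p` of length `D` with locators `ξ` in an extension field `K`: the words
over `𝔽_p` that lie in the kernel of `bchMatrix b ξ`. -/
def bchCode (p : ℕ) [Fact p.Prime] {K : Type*} [Field K] [Algebra (ZMod p) K] {D : ℕ} (b : ℕ)
    (ξ : Fin D → K) : Submodule (ZMod p) (Fin D → ZMod p) where
  carrier := {c | (bchMatrix b ξ).mulVec (fun t => algebraMap (ZMod p) K (c t)) = 0}
  zero_mem' := by
    ext j
    simp [Matrix.mulVec, dotProduct]
  add_mem' := by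
    intro x y hx hy
    have h : (fun t => algebraMap (ZMod p) K ((x + y) t)) =
        (fun t => algebraMap (ZMod p) K (x t)) + fun t => algebraMap (ZMod p) K (y t) := by
      ext t
      simp
    simp only [Set.mem_ofPred_eq] at hx hy ⊢
    rw [h, Matrix.mulVec_add, hx, hy, add_zero]
  smul_mem' := by
    intro r x hx
    have h : (fun t => algebraMap (ZMod p) K ((r • x) t)) =
        algebraMap (ZMod p) K r • fun t => algebraMap (ZMod p) K (x t) := by
      ext t
      simp
    simp only [Set.mem_ofPred_eq] at hx ⊢
    rw [h, Matrix.mulVec_smul, hx, smul_zero]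

/-- `[A iᵀ mod p]_p`. -/
def syndromeVal {p r D N : ℕ} (A : Matrix (Fin r) (Fin D) (ZMod p)) (i : Pos N D) : ℕ :=
  baseVal p fun l => (A.mulVec (fun t => ((i t : ℕ) : ZMod p)) l).val

/-- The binary parity-check matrix of the construction, with five layers of rows. The column at
`i` is `β^[Ai mod p]_p`, `β^(3[Ai mod p]_p)`, `⌊i/p⌋ mod 2`, `γ^[i mod p]_p`, `α^[i]_n`, where an
element of `𝔽_{2^k}` is expanded into `k` binary rows by the given isomorphism with `𝔽₂^k`. -/
noncomputable def parityCheckL1 {n p D r m a a' : ℕ}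
    (A : Matrix (Fin r) (Fin D) (ZMod p))
    (α : GaloisField 2 m) (β : GaloisField 2 a) (γ : GaloisField 2 a')
    (φm : GaloisField 2 m ≃ₗ[ZMod 2] (Fin m → ZMod 2))
    (φa : GaloisField 2 a ≃ₗ[ZMod 2] (Fin a → ZMod 2))
    (φa' : GaloisField 2 a' ≃ₗ[ZMod 2] (Fin a' → ZMod 2)) :
    Matrix (Fin a ⊕ Fin a ⊕ Fin D ⊕ Fin a' ⊕ Fin m) (Pos (n * p) D) (ZMod 2) :=
  Matrix.of fun row i =>
    Sum.elim (φa (β ^ syndromeVal A i))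
      (Sum.elim (φa (β ^ (3 * syndromeVal A i)))
        (Sum.elim (fun t => (((i t : ℕ) / p : ℕ) : ZMod 2))
          (Sum.elim (φa' (γ ^ baseVal p fun t => (i t : ℕ) % p))
            (φm (α ^ baseVal n fun t => (i t : ℕ)))))) row

end BurstCode

/-! It suffices that two bursts with equal syndromes coincide. Each layer reveals part of an
unordered pair of error positions `{i, j}`. The two `β` layers give a sum and a sum of cubes; in
characteristic two these determine the unordered pair of powers of `β`, hence the images of `i` and
`j` under `A`. By Newton's identities the BCH code over `𝔽_p` has minimum Lee distance at least `2b`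
(`eq_zero_of_power_checks`). The difference of two displacements of close positions has `L₁` norm
below `2b`, so these images fix `i - j`, and only a translation stays unknown.

Once `u - v` is known, `x ^ u + x ^ v = x ^ v * (x ^ (u - v) + 1)` determines `u` modulo the order
of `x`, provided the sum is nonzero (`IsPrimitiveElement.dvd_sub_of_add_eq_add`). The parities of
the quotients by `p` turn `i - j` into the difference of the residues, so `γ` yields `i mod p`. Then
`α` yields `[i]_n` modulo `2^m - 1`. With the residues known, only a multiple of `p` is in doubt,
and coprimality cancels `p`, leaving the quotients, which are true base-`n` digits. The `β` layers
also separate bursts of different weights, and a single error needs only `γ` and `α`. -/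

namespace BurstCode

/-! ### Power sums and the Lee distance of BCH codes. -/

/-- Over a field of characteristic `p`, two families of `N < p` elements with the same power sums
up to degree `N` have the same elementary symmetric functions. -/
theorem aeval_esymm_eq_of_psum_eq {K : Type*} [Field K] {p N : ℕ} [CharP K p]
    (hN : N < p) {f g : Fin N → K}
    (h : ∀ k, k ≤ N → ∑ i, f i ^ k = ∑ i, g i ^ k) (k : ℕ) (hk : k ≤ N) :
    MvPolynomial.aeval f (MvPolynomial.esymm (Fin N) K k) =
      MvPolynomial.aeval g (MvPolynomial.esymm (Fin N) K k) := by
  induction k using Nat.strong_induction_on with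
  | _ k ih =>
    rcases Nat.eq_zero_or_pos k with rfl | hpos
    · simp
    -- Since `0 < k ≤ N < p`, Newton's identity for `k * e_k` can be divided by `k`.
    have hk0 : (k : K) ≠ 0 := fun h0 =>
      absurd (Nat.le_of_dvd hpos ((CharP.cast_eq_zero_iff K p k).1 h0)) (by omega)
    have newton := MvPolynomial.mul_esymm_eq_sum (Fin N) K k
    have hf := congrArg (MvPolynomial.aeval f) newton
    have hg := congrArg (MvPolynomial.aeval g) newton
    simp only [map_mul, map_pow, map_neg, map_one, map_sum, map_natCast] at hf hg
    refine mul_left_cancel₀ hk0 ?_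
    rw [hf, hg]
    congr 1
    refine Finset.sum_congr rfl fun x hx => ?_
    obtain ⟨hx, hlt⟩ := Finset.mem_filter.1 hx
    have hsum := Finset.HasAntidiagonal.mem_antidiagonal.1 hx
    rw [ih x.1 hlt (by omega)]
    congr 1
    simpa [MvPolynomial.psum] using h x.2 (by omega)

/-- Over a field of characteristic `p`, a multiset of fewer than `p` elements is determined by its
power sums. -/
theorem multiset_eq_of_power_sums_eq {K : Type*} [Field K] {p : ℕ} [CharP K p] {S T : Multiset K}
    (hcard : S.card = T.card) (hS : S.card < p)
    (h : ∀ k, k ≤ S.card → (S.map (· ^ k)).sum = (T.map (· ^ k)).sum) : S = T := by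
  have enum (U : Multiset K) (N : ℕ) (hU : U.card = N) :
      ∃ f : Fin N → K, Finset.univ.val.map f = U := by
    subst hU
    induction U using Quotient.inductionOn with
    | _ l =>
      refine ⟨l.get, ?_⟩
      change ((List.finRange l.length).map l.get : Multiset K) = l
      rw [List.map_get_finRange]
  obtain ⟨f, hf⟩ := enum S S.card rfl
  obtain ⟨g, hg⟩ := enum T S.card hcard.symm
  have hsymm (k : ℕ) (hk : k ≤ S.card) : S.esymm k = T.esymm k := by
    have := aeval_esymm_eq_of_psum_eq hS (f := f) (g := g) (fun k hk => by
      have := h k hk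
      conv at this => lhs; rw [← hf]
      conv at this => rhs; rw [← hg]
      rwa [Multiset.map_map, Multiset.map_map] at this) k hk
    rwa [MvPolynomial.aeval_esymm_eq_multiset_esymm, MvPolynomial.aeval_esymm_eq_multiset_esymm,
      hf, hg] at this
  -- By Vieta, the monic polynomials with root multisets `S` and `T` have equal coefficients.
  have hprod : (S.map fun x => Polynomial.X - Polynomial.C x).prod =
      (T.map fun x => Polynomial.X - Polynomial.C x).prod := by
    rw [Multiset.prod_X_sub_X_eq_sum_esymm, Multiset.prod_X_sub_X_eq_sum_esymm, ← hcard]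
    refine Finset.sum_congr rfl fun k hk => ?_
    rw [hsymm k (by simpa [Nat.lt_succ_iff] using hk)]
  simpa using congrArg Polynomial.roots hprod

/-- The minimum Lee distance of a BCH code: a nonzero integer vector satisfying the `b` power sum
checks modulo `p` has `L₁` norm at least `2 * b`. -/
theorem eq_zero_of_power_checks {K : Type*} [Field K] {p b D : ℕ} [CharP K p]
    (hp : 2 * b + 1 ≤ p) (hb : 1 ≤ b) {ξ : Fin D → K} (hξ : Function.Injective ξ) {c : Fin D → ℤ}
    (hc : ∑ t, |c t| < 2 * b) (h : ∀ k, k < b → ∑ t, (c t : K) * ξ t ^ k = 0) : c = 0 := by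
  classical
  -- Positive and negative parts of `c`, used as multiplicities of the locators in two multisets.
  set u : Fin D → ℕ := fun t => (c t).toNat with hu
  set v : Fin D → ℕ := fun t => (-c t).toNat with hv
  have huv (t : Fin D) : c t = (u t : ℤ) - v t := by simp only [hu, hv]; omega
  have habs (t : Fin D) : |c t| = (u t : ℤ) + v t := by simp only [hu, hv]; grind
  have hbound : ∑ t, u t + ∑ t, v t < 2 * b := by
    zify
    rw [← Finset.sum_add_distrib]
    simpa only [habs] using hc
  have hsums (k : ℕ) (hk : k < b) : ∑ t, (u t : K) * ξ t ^ k = ∑ t, (v t : K) * ξ t ^ k := by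
    rw [← sub_eq_zero, ← Finset.sum_sub_distrib, ← h k hk]
    refine Finset.sum_congr rfl fun t _ => ?_
    rw [huv t]; push_cast; ring
  -- The degree-zero check gives equality modulo `p` only; both sizes are below `2b < p`.
  have hcards : ∑ t, u t = ∑ t, v t := by
    have h0 := hsums 0 hb
    simp only [pow_zero, mul_one, ← Nat.cast_sum] at h0
    have := (CharP.natCast_eq_natCast K p).1 h0
    exact Nat.ModEq.eq_of_lt_of_lt this (by omega) (by omega)
  have hmul : ∑ t, u t • ({ξ t} : Multiset K) = ∑ t, v t • ({ξ t} : Multiset K) := by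
    refine multiset_eq_of_power_sums_eq (p := p) ?_ ?_ fun k hk => ?_
    · simpa using hcards
    · simp; omega
    · have hsum (w : Fin D → ℕ) : ((∑ t, w t • ({ξ t} : Multiset K)).map (· ^ k)).sum =
          ∑ t, (w t : K) * ξ t ^ k := by
        rw [← Multiset.coe_mapAddMonoidHom, map_sum, ← Multiset.coe_sumAddMonoidHom, map_sum]
        simp [Multiset.map_nsmul, Multiset.sum_nsmul]
      rw [hsum, hsum]
      simp at hk
      -- The two sizes are equal with total below `2b`, so each is below `b` and the checks of
      -- degree `k < b` suffice.
      exact hsums k (by omega)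
  funext t
  have hcount (w : Fin D → ℕ) : (∑ t, w t • ({ξ t} : Multiset K)).count (ξ t) = w t := by
    simp [Multiset.count_sum', Multiset.count_nsmul, Multiset.count_singleton, hξ.eq_iff]
  have := congrArg (Multiset.count (ξ t)) hmul
  rw [hcount, hcount] at this
  rw [huv t, this]; simp

/-! ### Signed base-`q` expansions. -/

theorem abs_signed_digits_lt {q : ℕ} (hq : 1 ≤ q) {D : ℕ} (d : Fin D → ℤ) (hd : ∀ t, |d t| < q) :
    |∑ t, d t * (q : ℤ) ^ (t : ℕ)| < (q : ℤ) ^ D := by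
  induction D with
  | zero => simp
  | succ D ih =>
    have := ih (fun t => d t.castSucc) fun t => hd _
    rw [Fin.sum_univ_castSucc]
    simp only [Fin.val_castSucc, Fin.val_last]
    have hlast := hd (Fin.last D)
    have hpos : (0 : ℤ) < (q : ℤ) ^ D := by positivity
    calc _ ≤ |∑ t : Fin D, d t.castSucc * (q : ℤ) ^ (t : ℕ)| + |d (Fin.last D)| * (q : ℤ) ^ D := by
          refine (abs_add_le _ _).trans_eq ?_
          rw [abs_mul, abs_of_pos hpos]
      _ < (q : ℤ) ^ D + (q - 1) * (q : ℤ) ^ D := by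
          refine add_lt_add_of_lt_of_le this ?_
          exact mul_le_mul_of_nonneg_right (by omega) hpos.le
      _ = _ := by ring

/-- Modulo `q` only the lowest digit survives, and it is smaller than `q` in absolute value; divide
by `q` and repeat. -/
theorem eq_zero_of_signed_digits_eq_zero {q D : ℕ} (d : Fin D → ℤ) (hd : ∀ t, |d t| < q)
    (h : ∑ t, d t * (q : ℤ) ^ (t : ℕ) = 0) : d = 0 := by
  induction D with
  | zero => exact Subsingleton.elim _ _
  | succ D ih =>
    rw [Fin.sum_univ_succ] at h
    have hfactor : ∑ t : Fin D, d t.succ * (q : ℤ) ^ (t.succ : ℕ) =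
        q * ∑ t : Fin D, d t.succ * (q : ℤ) ^ (t : ℕ) := by
      rw [Finset.mul_sum]
      exact Finset.sum_congr rfl fun t _ => by rw [Fin.val_succ]; ring
    rw [hfactor] at h
    simp only [Fin.val_zero, pow_zero, mul_one] at h
    have h0 : d 0 = 0 := Int.eq_zero_of_abs_lt_dvd
      ⟨-∑ t : Fin D, d t.succ * (q : ℤ) ^ (t : ℕ), by linarith⟩ (hd 0)
    have hq : (q : ℤ) ≠ 0 := fun hq => absurd (hd 0) (by simp [hq])
    rw [h0, zero_add] at h
    have htail := ih (fun t => d t.succ) (fun t => hd _) ((mul_eq_zero.1 h).resolve_left hq)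
    funext t
    refine Fin.cases h0 (fun t => congrFun htail t) t

/-- The expansion is smaller than `q ^ D ≤ M` in absolute value, so a multiple of `M` of this form
is zero. Here `M` will be the order of a primitive element. -/
theorem eq_zero_of_dvd_signed_digits {q D M : ℕ} (hM : q ^ D ≤ M) (d : Fin D → ℤ)
    (hd : ∀ t, |d t| < q) (h : (M : ℤ) ∣ ∑ t, d t * (q : ℤ) ^ (t : ℕ)) : d = 0 := by
  rcases Nat.eq_zero_or_pos q with rfl | hq
  · funext t
    exact absurd (hd t) (by simp)
  refine eq_zero_of_signed_digits_eq_zero d hd (Int.eq_zero_of_abs_lt_dvd h ?_)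
  exact (abs_signed_digits_lt hq d hd).trans_le (by exact_mod_cast hM)

theorem baseVal_sub_baseVal {D : ℕ} (q : ℕ) (x y : Fin D → ℕ) :
    (baseVal q x : ℤ) - baseVal q y = ∑ t, ((x t : ℤ) - y t) * (q : ℤ) ^ (t : ℕ) := by
  simp [baseVal, sub_mul, Finset.sum_sub_distrib]

theorem abs_natCast_sub_lt {x y q : ℕ} (hx : x < q) (hy : y < q) : |(x : ℤ) - y| < q := by
  rw [abs_lt]
  omega

theorem eq_of_dvd_baseVal_sub {q D M : ℕ} (hM : q ^ D ≤ M) {x y : Fin D → ℕ}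
    (hx : ∀ t, x t < q) (hy : ∀ t, y t < q) (h : (M : ℤ) ∣ baseVal q x - baseVal q y) : x = y := by
  rw [baseVal_sub_baseVal] at h
  have := eq_zero_of_dvd_signed_digits hM (fun t => (x t : ℤ) - y t)
    (fun t => abs_natCast_sub_lt (hx t) (hy t)) h
  funext t
  have := congrFun this t
  simp at this
  omega

/-! ### Primitive elements and sums of two elements in characteristic two. -/

theorem IsPrimitiveElement.ne_zero {K : Type*} [Field K] {x : K} (hx : IsPrimitiveElement x) :
    x ≠ 0 := by
  obtain ⟨u, rfl, -⟩ := hx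
  exact u.ne_zero

theorem IsPrimitiveElement.dvd_sub_of_pow_eq {k : ℕ} (hk : k ≠ 0) {x : GaloisField 2 k}
    (hx : IsPrimitiveElement x) {i j : ℕ} (h : x ^ i = x ^ j) :
    ((2 ^ k - 1 : ℕ) : ℤ) ∣ (i : ℤ) - j := by
  obtain ⟨u, rfl, hu⟩ := hx
  have hord : orderOf u = 2 ^ k - 1 := by
    rw [orderOf_eq_card_of_forall_mem_zpowers hu, Nat.card_units, GaloisField.card 2 k hk]
  rw [← hord, orderOf_dvd_sub_iff_zpow_eq_zpow, zpow_natCast, zpow_natCast]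
  exact Units.ext (by simpa using h)

/-- A sum of two distinct powers of a primitive element with a known difference of exponents
determines the exponents. -/
theorem IsPrimitiveElement.dvd_sub_of_add_eq_add {k : ℕ} (hk : k ≠ 0) {x : GaloisField 2 k}
    (hx : IsPrimitiveElement x) {i j i' j' : ℕ} (hdiff : (i : ℤ) - j = i' - j')
    (hij : ¬ ((2 ^ k - 1 : ℕ) : ℤ) ∣ (i : ℤ) - j) (h : x ^ i + x ^ j = x ^ i' + x ^ j') :
    ((2 ^ k - 1 : ℕ) : ℤ) ∣ (i : ℤ) - i' := by
  refine hx.dvd_sub_of_pow_eq hk ?_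
  -- The exponents agree because `i + j' = i' + j`. With `h` this gives `x ^ i * (x ^ i + x ^ j) = x
  -- ^ i' * (x ^ i + x ^ j)`, and the common factor is nonzero by `hij`.
  have hmul : x ^ i * x ^ j' = x ^ i' * x ^ j := by
    rw [← pow_add, ← pow_add]; congr 1; omega
  have hne : x ^ i + x ^ j ≠ 0 := fun h0 =>
    hij (hx.dvd_sub_of_pow_eq hk (CharTwo.add_eq_zero.1 h0))
  refine mul_right_cancel₀ hne ?_
  linear_combination (x ^ i) * h + hmul

/-- In characteristic two, a pair of distinct elements is determined by its sum and its sum of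
cubes. -/
theorem pair_eq_of_add_eq_of_cube_add_eq {K : Type*} [Field K] [CharP K 2] {x y z w : K}
    (hne : x ≠ y) (h : x + y = z + w) (h3 : x ^ 3 + y ^ 3 = z ^ 3 + w ^ 3) :
    (x = z ∧ y = w) ∨ (x = w ∧ y = z) := by
  have h2 : (2 : K) = 0 := CharTwo.two_eq_zero
  have hs : x + y ≠ 0 := fun h0 => hne (CharTwo.add_eq_zero.1 h0)
  -- In characteristic two `x³ + y³ = (x + y)³ + xy(x + y)`, so the hypotheses give `(x + y)(xy -
  -- zw) = 0`, while `(x - z)(x - w) = zw - xy`.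
  have hprod : (x + y) * ((x - z) * (x - w)) = 0 := by
    have hw : w = x + y - z := by linear_combination -h
    subst hw
    linear_combination h3 - (x + y) * (z * (x + y - z) - x * y) * h2
  rcases mul_eq_zero.1 ((mul_eq_zero.1 hprod).resolve_left hs) with hx | hx
  · exact Or.inl ⟨sub_eq_zero.1 hx, by linear_combination h - hx⟩
  · exact Or.inr ⟨sub_eq_zero.1 hx, by linear_combination h - hx⟩

/-- In characteristic two, `(x + y)³` exceeds `x³ + y³` by `xy(x + y)`, which is nonzero here. This
separates a single error from a pair. -/
theorem cube_add_cube_ne {K : Type*} [Field K] [CharP K 2] {x y z : K} (hx : x ≠ 0) (hy : y ≠ 0)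
    (hz : z ≠ 0) (h : x + y = z) : x ^ 3 + y ^ 3 ≠ z ^ 3 := by
  subst h
  intro h3
  have h2 : (2 : K) = 0 := CharTwo.two_eq_zero
  refine mul_ne_zero (mul_ne_zero hx hy) hz ?_
  linear_combination -h3 - (x ^ 2 * y + x * y ^ 2) * h2

/-! ### Decoding, bursts and syndromes. -/

theorem corrects_of_sub_mem_imp_eq {ι : Type*} {C : Submodule (ZMod 2) (ι → ZMod 2)}
    {E : Set (ι → ZMod 2)} (h : ∀ e ∈ E, ∀ e' ∈ E, e - e' ∈ C → e = e') : Corrects C E := by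
  classical
  -- The decoder picks any codeword that explains `y`; the value `0` on unexplained words is
  -- arbitrary.
  refine ⟨fun y => if hy : ∃ c ∈ C, ∃ e ∈ E, c + e = y then hy.choose else 0, ?_⟩
  intro c hc e he
  have hy : ∃ c' ∈ C, ∃ e' ∈ E, c' + e' = c + e := ⟨c, hc, e, he, rfl⟩
  refine (dif_pos hy).trans ?_
  obtain ⟨hc', e', he', heq⟩ := hy.choose_spec
  have hdiff : e - e' = hy.choose - c := by linear_combination -heq
  have := h e he e' he' (hdiff ▸ C.sub_mem hc' hc)
  subst this
  exact add_right_cancel heq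

/-- A `2`-weight-limited burst is zero, a single error, or a pair of errors at close positions. -/
theorem eq_zero_or_single_or_pair_of_mem_burstsL1 {N D b : ℕ} {e : Arr N D}
    (he : e ∈ burstsL1 N D b) :
    e = 0 ∨ (∃ i, e = Pi.single i 1) ∨
      ∃ i j, i ≠ j ∧ IsCloseL1 b i j ∧ e = Pi.single i 1 + Pi.single j 1 := by
  have hbit (x : ZMod 2) (hx : x ≠ 0) : x = 1 := by revert x; decide
  rcases he with he | ⟨he, i, j, hij, hi, hj, hclose⟩
  · rw [hammingNorm, Finset.card_le_one] at he
    by_cases h0 : e = 0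
    · exact Or.inl h0
    obtain ⟨i, hi⟩ := Function.ne_iff.1 h0
    refine Or.inr (Or.inl ⟨i, funext fun k => ?_⟩)
    by_cases hk : k = i
    · subst hk
      simpa using hbit _ hi
    · rw [Pi.single_eq_of_ne hk]
      by_contra hne
      exact hk (he k (by simpa using hne) i (by simpa using hi))
  · refine Or.inr (Or.inr ⟨i, j, hij, hclose, funext fun k => ?_⟩)
    by_cases hki : k = i
    · subst hki
      simp [hi, hij]
    by_cases hkj : k = j
    · subst hkj
      simp [hj, hki]
    rw [Pi.add_apply, Pi.single_eq_of_ne hki, Pi.single_eq_of_ne hkj, add_zero]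
    by_contra hne
    have hsub : ({k, i, j} : Finset (Pos N D)) ⊆ Finset.univ.filter fun x => e x ≠ 0 := by
      intro x hx
      simp only [Finset.mem_insert, Finset.mem_singleton] at hx
      rcases hx with rfl | rfl | rfl <;> simp [hi, hj, hne]
    have hcard := Finset.card_le_card hsub
    rw [Finset.card_eq_three.2 ⟨k, i, j, hki, hkj, hij, rfl⟩] at hcard
    rw [hammingNorm] at he
    omega

/-- Arrays with equal syndromes have equal syndromes in every layer of the parity-check matrix. -/
theorem layers_eq_of_sub_mem {n p D r m a a' : ℕ} {A : Matrix (Fin r) (Fin D) (ZMod p)}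
    {α : GaloisField 2 m} {β : GaloisField 2 a} {γ : GaloisField 2 a'}
    {φm : GaloisField 2 m ≃ₗ[ZMod 2] (Fin m → ZMod 2)}
    {φa : GaloisField 2 a ≃ₗ[ZMod 2] (Fin a → ZMod 2)}
    {φa' : GaloisField 2 a' ≃ₗ[ZMod 2] (Fin a' → ZMod 2)} {e e' : Arr (n * p) D}
    (h : e - e' ∈ codeOf (parityCheckL1 (n := n) A α β γ φm φa φa')) :
    (Fintype.linearCombination (ZMod 2) (fun i => β ^ syndromeVal A i) e =
      Fintype.linearCombination (ZMod 2) (fun i => β ^ syndromeVal A i) e') ∧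
    (Fintype.linearCombination (ZMod 2) (fun i => β ^ (3 * syndromeVal A i)) e =
      Fintype.linearCombination (ZMod 2) (fun i => β ^ (3 * syndromeVal A i)) e') ∧
    (Fintype.linearCombination (ZMod 2)
        (fun (i : Pos (n * p) D) t => (((i t : ℕ) / p : ℕ) : ZMod 2)) e =
      Fintype.linearCombination (ZMod 2)
        (fun (i : Pos (n * p) D) t => (((i t : ℕ) / p : ℕ) : ZMod 2)) e') ∧
    (Fintype.linearCombination (ZMod 2)
        (fun i : Pos (n * p) D => γ ^ baseVal p fun t => (i t : ℕ) % p) e =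
      Fintype.linearCombination (ZMod 2)
        (fun i : Pos (n * p) D => γ ^ baseVal p fun t => (i t : ℕ) % p) e') ∧
    (Fintype.linearCombination (ZMod 2)
        (fun i : Pos (n * p) D => α ^ baseVal n fun t => (i t : ℕ)) e =
      Fintype.linearCombination (ZMod 2)
        (fun i : Pos (n * p) D => α ^ baseVal n fun t => (i t : ℕ)) e') := by
  set H := parityCheckL1 (n := n) A α β γ φm φa φa'
  have hrow (x) : ∑ i, H x i * (e - e') i = 0 := by
    rw [codeOf, LinearMap.mem_ker] at h
    exact congrFun h x
  -- Injectivity of `φ` turns the `k` binary equations back into one equation in the field.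
  have expand {k : ℕ} (φ : GaloisField 2 k ≃ₗ[ZMod 2] (Fin k → ZMod 2))
      (X : Pos (n * p) D → GaloisField 2 k)
      (hX : ∀ l, ∑ i, φ (X i) l * (e - e') i = 0) :
      Fintype.linearCombination (ZMod 2) X e = Fintype.linearCombination (ZMod 2) X e' := by
    rw [← sub_eq_zero, ← map_sub]
    refine φ.injective (funext fun l => ?_)
    rw [Fintype.linearCombination_apply, map_sum, map_zero, Finset.sum_apply, Pi.zero_apply,
      ← hX l]
    exact Finset.sum_congr rfl fun i _ => by
      rw [map_smul, Pi.smul_apply, smul_eq_mul, mul_comm]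
  refine ⟨expand φa _ fun l => hrow (Sum.inl l), expand φa _ fun l => hrow (Sum.inr (Sum.inl l)),
    ?_, expand φa' _ fun l => hrow (Sum.inr (Sum.inr (Sum.inr (Sum.inl l)))),
    expand φm _ fun l => hrow (Sum.inr (Sum.inr (Sum.inr (Sum.inr l))))⟩
  rw [← sub_eq_zero, ← map_sub]
  funext l
  rw [Fintype.linearCombination_apply, Finset.sum_apply, Pi.zero_apply,
    ← hrow (Sum.inr (Sum.inr (Sum.inl l)))]
  exact Finset.sum_congr rfl fun i _ => by
    rw [Pi.smul_apply, smul_eq_mul, mul_comm]; rfl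

/-! ### Recovering a position from residues and base-`n` values. -/

/-- For two pairs of integers with the same small difference, the parity of the sum of the
quotients by `p` determines the difference of the remainders. -/
theorem mod_sub_mod_eq_of_div_parity {p i j i' j' : ℕ} (hlt : |(i : ℤ) - j| < p)
    (hdiff : (i : ℤ) - j = i' - j')
    (hpar : ((i / p : ℕ) : ZMod 2) + ((j / p : ℕ) : ZMod 2) =
      ((i' / p : ℕ) : ZMod 2) + ((j' / p : ℕ) : ZMod 2)) :
    ((i % p : ℕ) : ℤ) - (j % p : ℕ) = (i' % p : ℕ) - (j' % p : ℕ) := by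
  have hp : 0 < p := by have := abs_nonneg ((i : ℤ) - j); omega
  have hmod : (i / p + j / p) % 2 = (i' / p + j' / p) % 2 := by
    refine (ZMod.natCast_eq_natCast_iff' _ _ 2).1 ?_
    push_cast
    exact hpar
  -- Numbers less than `p` apart have quotients differing by at most one, in the direction of `i -
  -- j`. That direction is common to both pairs, so parity decides between equal and adjacent
  -- quotients.
  have key : ∀ i j : ℕ, |(i : ℤ) - j| < p →
      i / p = j / p ∨ (i / p = j / p + 1 ∧ j < i) ∨ (j / p = i / p + 1 ∧ i < j) := by
    intro i j h
    rw [abs_lt] at h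
    rcases lt_trichotomy (i / p) (j / p) with hlt | heq | hgt
    · have h1 : j / p ≤ (i + p) / p := Nat.div_le_div_right (by omega)
      rw [Nat.add_div_right _ hp] at h1
      have h2 : i < j := Nat.lt_of_div_lt_div hlt
      omega
    · exact Or.inl heq
    · have h1 : i / p ≤ (j + p) / p := Nat.div_le_div_right (by omega)
      rw [Nat.add_div_right _ hp] at h1
      have h2 : j < i := Nat.lt_of_div_lt_div hgt
      omega
  have hquot : ((i / p : ℕ) : ℤ) - (j / p : ℕ) = (i' / p : ℕ) - (j' / p : ℕ) := by
    have h1 := key i j hlt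
    have h2 := key i' j' (hdiff ▸ hlt)
    omega
  have e1 : (p : ℤ) * (i / p : ℕ) + (i % p : ℕ) = i := by exact_mod_cast Nat.div_add_mod i p
  have e2 : (p : ℤ) * (j / p : ℕ) + (j % p : ℕ) = j := by exact_mod_cast Nat.div_add_mod j p
  have e3 : (p : ℤ) * (i' / p : ℕ) + (i' % p : ℕ) = i' := by exact_mod_cast Nat.div_add_mod i' p
  have e4 : (p : ℤ) * (j' / p : ℕ) + (j' % p : ℕ) = j' := by exact_mod_cast Nat.div_add_mod j' p
  linear_combination e1 - e2 - e3 + e4 + hdiff - p * hquot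

/-- A position is determined by its residues modulo `p` and its base-`n` value modulo `M`. -/
theorem pos_eq_of_mod_eq_of_dvd_baseVal_sub {n p D M : ℕ} (hM : n ^ D ≤ M)
    (hgcd : Nat.gcd p M = 1) {i i' : Pos (n * p) D} (hmod : ∀ t, (i t : ℕ) % p = (i' t : ℕ) % p)
    (h : (M : ℤ) ∣ (baseVal n fun t => (i t : ℕ) : ℕ) - (baseVal n fun t => (i' t : ℕ) : ℕ)) :
    i = i' := by
  rw [baseVal_sub_baseVal] at h
  have hsplit (t : Fin D) : ((i t : ℕ) : ℤ) - (i' t : ℕ) =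
      p * (((i t : ℕ) / p : ℕ) - ((i' t : ℕ) / p : ℕ)) := by
    have e1 : (p : ℤ) * ((i t : ℕ) / p : ℕ) + ((i t : ℕ) % p : ℕ) = (i t : ℕ) := by
      exact_mod_cast Nat.div_add_mod (i t : ℕ) p
    have e2 : (p : ℤ) * ((i' t : ℕ) / p : ℕ) + ((i' t : ℕ) % p : ℕ) = (i' t : ℕ) := by
      exact_mod_cast Nat.div_add_mod (i' t : ℕ) p
    rw [← hmod t] at e2
    linear_combination e2 - e1
  simp only [hsplit, mul_assoc, ← Finset.mul_sum] at h
  have hcop : IsCoprime (M : ℤ) (p : ℤ) := by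
    rw [Nat.isCoprime_iff_coprime, Nat.coprime_comm]
    exact hgcd
  -- After cancelling `p`, the digits are differences of quotients, which lie below `n` although the
  -- coordinates themselves need not.
  have hzero := eq_zero_of_dvd_signed_digits hM _ (fun t => ?_) (hcop.dvd_of_dvd_mul_left h)
  · funext t
    have := hsplit t
    have h0 := congrFun hzero t
    simp only [Pi.zero_apply] at h0
    rw [h0, mul_zero] at this
    exact Fin.ext (by omega)
  · have hdiv (k : Fin (n * p)) : (k : ℕ) / p < n :=
      Nat.div_lt_of_lt_mul (k.2.trans_eq (mul_comm n p))
    exact abs_natCast_sub_lt (hdiv _) (hdiv _)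

/-! ### The BCH checks applied to close positions. -/

/-- The Lee distance of the BCH code, in terms of a parity-check matrix of the code. -/
theorem eq_zero_of_mulVec_eq_zero {p b D s r : ℕ} [Fact p.Prime] (hp : 2 * b + 1 ≤ p) (hb : 1 ≤ b)
    {ξ : Fin D → GaloisField p s} (hξ : Function.Injective ξ)
    {A : Matrix (Fin r) (Fin D) (ZMod p)} (hA : codeOf A = bchCode p b ξ) {c : Fin D → ℤ}
    (hc : ∑ t, |c t| < 2 * b) (h : A.mulVec (fun t => (c t : ZMod p)) = 0) : c = 0 := by
  have hmem : (fun t => (c t : ZMod p)) ∈ bchCode p b ξ := hA ▸ h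
  have : CharP (GaloisField p s) p := charP_of_injective_algebraMap
    (algebraMap (ZMod p) (GaloisField p s)).injective p
  refine eq_zero_of_power_checks (K := GaloisField p s) hp hb hξ hc fun k hk => ?_
  have := congrFun (show (bchMatrix b ξ).mulVec _ = 0 from hmem) ⟨k, hk⟩
  simpa [Matrix.mulVec, dotProduct, bchMatrix, mul_comm] using this

theorem mulVec_eq_of_dvd_syndromeVal_sub {p r D N M : ℕ} [NeZero p] (hM : p ^ r ≤ M)
    {A : Matrix (Fin r) (Fin D) (ZMod p)} {i j : Pos N D}
    (h : (M : ℤ) ∣ (syndromeVal A i : ℤ) - syndromeVal A j) :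
    A.mulVec (fun t => ((i t : ℕ) : ZMod p)) = A.mulVec (fun t => ((j t : ℕ) : ZMod p)) := by
  have := eq_of_dvd_baseVal_sub hM (fun t => ZMod.val_lt _) (fun t => ZMod.val_lt _) h
  funext l
  exact ZMod.val_injective p (congrFun this l)

theorem IsCloseL1.abs_sub_lt {N D b : ℕ} {i j : Pos N D} (h : IsCloseL1 b i j) (t : Fin D) :
    |((i t : ℕ) : ℤ) - (j t : ℕ)| < b :=
  (Finset.single_le_sum (f := fun t => |((i t : ℕ) : ℤ) - (j t : ℕ)|)
    (fun _ _ => abs_nonneg _) (Finset.mem_univ t)).trans_lt h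

theorem IsCloseL1.symm {N D b : ℕ} {i j : Pos N D} (h : IsCloseL1 b i j) : IsCloseL1 b j i := by
  simpa only [IsCloseL1, abs_sub_comm] using h

/-- Close positions with the same image under a parity-check matrix of the BCH code are equal. -/
theorem IsCloseL1.eq_of_mulVec_eq {p b D s r N : ℕ} [Fact p.Prime] (hp : 2 * b + 1 ≤ p)
    (hb : 1 ≤ b) {ξ : Fin D → GaloisField p s} (hξ : Function.Injective ξ)
    {A : Matrix (Fin r) (Fin D) (ZMod p)} (hA : codeOf A = bchCode p b ξ) {i j : Pos N D}
    (hij : IsCloseL1 b i j)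
    (h : A.mulVec (fun t => ((i t : ℕ) : ZMod p)) = A.mulVec (fun t => ((j t : ℕ) : ZMod p))) :
    i = j := by
  have hzero : (fun t => ((i t : ℕ) : ℤ) - (j t : ℕ)) = 0 := by
    refine eq_zero_of_mulVec_eq_zero hp hb hξ hA (hij.trans (by omega)) ?_
    rw [← sub_eq_zero.2 h, ← Matrix.mulVec_sub]
    congr 1
    funext t
    simp
  funext t
  have := congrFun hzero t
  exact Fin.ext (by simpa [sub_eq_zero] using this)

/-- Two pairs of close positions with the same images under a parity-check matrix of the BCH code
are translates of each other. -/
theorem sub_eq_sub_of_mulVec_eq {p b D s r N : ℕ} [Fact p.Prime] (hp : 2 * b + 1 ≤ p)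
    (hb : 1 ≤ b) {ξ : Fin D → GaloisField p s} (hξ : Function.Injective ξ)
    {A : Matrix (Fin r) (Fin D) (ZMod p)} (hA : codeOf A = bchCode p b ξ) {i j i' j' : Pos N D}
    (hij : IsCloseL1 b i j) (hij' : IsCloseL1 b i' j')
    (hi : A.mulVec (fun t => ((i t : ℕ) : ZMod p)) = A.mulVec (fun t => ((i' t : ℕ) : ZMod p)))
    (hj : A.mulVec (fun t => ((j t : ℕ) : ZMod p)) = A.mulVec (fun t => ((j' t : ℕ) : ZMod p)))
    (t : Fin D) : ((i t : ℕ) : ℤ) - (j t : ℕ) = (i' t : ℕ) - (j' t : ℕ) := by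
  have hzero : (fun t => (((i t : ℕ) : ℤ) - (j t : ℕ)) - ((i' t : ℕ) - (j' t : ℕ))) = 0 := by
    refine eq_zero_of_mulVec_eq_zero hp hb hξ hA ?_ ?_
    -- Each displacement has norm below `b`, so their difference stays under the Lee distance bound
    -- `2b`.
    · refine (Finset.sum_le_sum fun t _ => abs_sub _ _).trans_lt ?_
      rw [Finset.sum_add_distrib, two_mul]
      exact add_lt_add hij hij'
    · have : (fun t => (((((i t : ℕ) : ℤ) - (j t : ℕ)) - ((i' t : ℕ) - (j' t : ℕ)) : ℤ) : ZMod p))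
          = ((fun t => ((i t : ℕ) : ZMod p)) - fun t => ((j t : ℕ) : ZMod p)) -
            ((fun t => ((i' t : ℕ) : ZMod p)) - fun t => ((j' t : ℕ) : ZMod p)) := by
        funext t
        simp
      rw [this, Matrix.mulVec_sub, Matrix.mulVec_sub, Matrix.mulVec_sub, hi, hj, sub_self]
  exact sub_eq_zero.1 (congrFun hzero t)

/-- Two translates `(i, j)` and `(i', j')` of a pair of close positions with the same last three
layers of the syndrome start at the same position. -/
theorem eq_of_translate_of_layers_eq {n p b D m a' : ℕ} (hn : b ≤ n) (hp : b ≤ p)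
    (hm0 : m ≠ 0) (ha0 : a' ≠ 0) (hm : n ^ D ≤ 2 ^ m - 1) (ha : p ^ D ≤ 2 ^ a' - 1)
    (hgcd : Nat.gcd p (2 ^ m - 1) = 1) {α : GaloisField 2 m} {γ : GaloisField 2 a'}
    (hα : IsPrimitiveElement α) (hγ : IsPrimitiveElement γ) {i j i' j' : Pos (n * p) D}
    (hne : i ≠ j) (hij : IsCloseL1 b i j)
    (hdiff : ∀ t, ((i t : ℕ) : ℤ) - (j t : ℕ) = (i' t : ℕ) - (j' t : ℕ))
    (hpar : ∀ t, (((i t : ℕ) / p : ℕ) : ZMod 2) + (((j t : ℕ) / p : ℕ) : ZMod 2) =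
      (((i' t : ℕ) / p : ℕ) : ZMod 2) + (((j' t : ℕ) / p : ℕ) : ZMod 2))
    (hγs : (γ ^ baseVal p fun t => (i t : ℕ) % p) + (γ ^ baseVal p fun t => (j t : ℕ) % p) =
      (γ ^ baseVal p fun t => (i' t : ℕ) % p) + (γ ^ baseVal p fun t => (j' t : ℕ) % p))
    (hαs : (α ^ baseVal n fun t => (i t : ℕ)) + (α ^ baseVal n fun t => (j t : ℕ)) =
      (α ^ baseVal n fun t => (i' t : ℕ)) + (α ^ baseVal n fun t => (j' t : ℕ))) :
    i = i' := by
  have hclose (t : Fin D) := hij.abs_sub_lt t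
  have hp0 : 0 < p := by
    rcases Nat.eq_zero_or_pos p with rfl | h
    · exact absurd (funext fun t => absurd (i t).2 (by simp)) hne
    · exact h
  have hmodlt (k : ℕ) : k % p < p := Nat.mod_lt _ hp0
  have hmod : (fun t => (i t : ℕ) % p) = fun t => (i' t : ℕ) % p := by
    refine eq_of_dvd_baseVal_sub ha (fun _ => hmodlt _) (fun _ => hmodlt _)
      (hγ.dvd_sub_of_add_eq_add ha0 ?_ (fun hdvd => hne ?_) hγs)
    · rw [baseVal_sub_baseVal, baseVal_sub_baseVal]
      refine Finset.sum_congr rfl fun t _ => ?_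
      rw [mod_sub_mod_eq_of_div_parity ((hclose t).trans_le (by exact_mod_cast hp)) (hdiff t)
        (hpar t)]
    -- The two powers of `γ` differ: equal residues would make `p` divide every `i t - j t`, of size
    -- below `b ≤ p`.
    · have := eq_of_dvd_baseVal_sub ha (fun _ => hmodlt _) (fun _ => hmodlt _) hdvd
      funext t
      have hdvd : (p : ℤ) ∣ ((i t : ℕ) : ℤ) - (j t : ℕ) :=
        (Nat.modEq_iff_dvd.1 (congrFun this t).symm)
      have := Int.eq_zero_of_abs_lt_dvd hdvd ((hclose t).trans_le (by exact_mod_cast hp))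
      exact Fin.ext (by omega)
  refine pos_eq_of_mod_eq_of_dvd_baseVal_sub hm hgcd (congrFun hmod)
    (hα.dvd_sub_of_add_eq_add hm0 ?_ (fun hdvd => hne ?_) hαs)
  · rw [baseVal_sub_baseVal, baseVal_sub_baseVal]
    exact Finset.sum_congr rfl fun t _ => by rw [hdiff t]
  -- The two powers of `α` differ: `b ≤ n` makes the coordinate differences admissible signed
  -- base-`n` digits.
  · rw [baseVal_sub_baseVal] at hdvd
    have := eq_zero_of_dvd_signed_digits hm _
      (fun t => (hclose t).trans_le (by exact_mod_cast hn)) hdvd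
    funext t
    have := congrFun this t
    exact Fin.ext (by simpa [sub_eq_zero] using this)

end BurstCode

/-! ### Comparison of two bursts with equal syndromes. -/

theorem mainTheorem6 (n b D p s r m a a' : ℕ)
    (hb : 2 ≤ b) (hn : b ≤ n) (hD : 1 ≤ D)
    [Fact p.Prime] (hp : IsLeast {q : ℕ | q.Prime ∧ 2 * b + 1 ≤ q} p)
    (hs : s = Nat.clog p (D + 1))
    (ξ : Fin D → GaloisField p s) (hξ : Function.Injective ξ)
    (hr : r = BurstCode.redundancy (BurstCode.bchCode p b ξ))
    (A : Matrix (Fin r) (Fin D) (ZMod p))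
    (hA : BurstCode.codeOf A = BurstCode.bchCode p b ξ)
    (hm : m = Nat.clog 2 (n ^ D + 1))
    (ha : a = Nat.clog 2 (p ^ r + 1))
    (ha' : a' = Nat.clog 2 (p ^ D + 1))
    (hgcd : Nat.gcd p (2 ^ m - 1) = 1)
    (α : GaloisField 2 m) (β : GaloisField 2 a) (γ : GaloisField 2 a')
    (hα : BurstCode.IsPrimitiveElement α) (hβ : BurstCode.IsPrimitiveElement β)
    (hγ : BurstCode.IsPrimitiveElement γ)
    (φm : GaloisField 2 m ≃ₗ[ZMod 2] (Fin m → ZMod 2))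
    (φa : GaloisField 2 a ≃ₗ[ZMod 2] (Fin a → ZMod 2))
    (φa' : GaloisField 2 a' ≃ₗ[ZMod 2] (Fin a' → ZMod 2))
    (C : Submodule (ZMod 2) (BurstCode.Arr (n * p) D))
    (hC : C = BurstCode.codeOf (BurstCode.parityCheckL1 (n := n) A α β γ φm φa φa')) :
    (∃ k : ℕ, BurstCode.HasParameters C ((n * p) ^ D) k) ∧
      BurstCode.Corrects C (BurstCode.burstsL1 (n * p) D b) := by
  refine ⟨⟨_, by simp, rfl⟩, BurstCode.corrects_of_sub_mem_imp_eq fun e he e' he' hmem => ?_⟩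
  have hp2 : 2 * b + 1 ≤ p := hp.1.2
  have hp0 : 0 < p := by omega
  have hb1 : 1 ≤ b := by omega
  -- The `+ 1` inside each logarithm makes the multiplicative group order `2 ^ k - 1` at least `x`,
  -- the number of exponents to be told apart.
  have hclog {x k : ℕ} (hx : 0 < x) (hk : k = Nat.clog 2 (x + 1)) : k ≠ 0 ∧ x ≤ 2 ^ k - 1 := by
    have hle : x + 1 ≤ 2 ^ k := hk ▸ Nat.le_pow_clog Nat.one_lt_two _
    refine ⟨?_, by omega⟩
    rintro rfl
    omega
  obtain ⟨hm0, hmle⟩ := hclog (pow_pos (by omega) D) hm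
  obtain ⟨ha0, hale⟩ := hclog (pow_pos hp0 r) ha
  obtain ⟨ha'0, ha'le⟩ := hclog (pow_pos hp0 D) ha'
  have hne0 (k : ℕ) : β ^ k ≠ 0 := pow_ne_zero k hβ.ne_zero
  have hsyn {i j : BurstCode.Pos (n * p) D}
      (h : β ^ BurstCode.syndromeVal A i = β ^ BurstCode.syndromeVal A j) :=
    BurstCode.mulVec_eq_of_dvd_syndromeVal_sub hale (hβ.dvd_sub_of_pow_eq ha0 h)
  have hpair_ne {i j : BurstCode.Pos (n * p) D} (hij : i ≠ j) (hc : BurstCode.IsCloseL1 b i j) :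
      β ^ BurstCode.syndromeVal A i ≠ β ^ BurstCode.syndromeVal A j :=
    fun h => hij (hc.eq_of_mulVec_eq hp2 hb1 hξ hA (hsyn h))
  obtain ⟨l1, l3, lq, lγ, lα⟩ := BurstCode.layers_eq_of_sub_mem (hC ▸ hmem)
  rcases BurstCode.eq_zero_or_single_or_pair_of_mem_burstsL1 he with
    rfl | ⟨i, rfl⟩ | ⟨i, j, hij, hc, rfl⟩ <;>
  rcases BurstCode.eq_zero_or_single_or_pair_of_mem_burstsL1 he' with
    rfl | ⟨i', rfl⟩ | ⟨i', j', hij', hc', rfl⟩ <;>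
  simp only [map_add, map_zero, Fintype.linearCombination_apply_single, one_smul] at l1 l3 lq lγ lα
  · rfl
  · exact absurd l1.symm (hne0 _)
  · exact absurd (CharTwo.add_eq_zero.1 l1.symm) (hpair_ne hij' hc')
  · exact absurd l1 (hne0 _)
  · have hmod := BurstCode.eq_of_dvd_baseVal_sub ha'le (fun _ => Nat.mod_lt _ hp0)
      (fun _ => Nat.mod_lt _ hp0) (hγ.dvd_sub_of_pow_eq ha'0 lγ)
    rw [BurstCode.pos_eq_of_mod_eq_of_dvd_baseVal_sub hmle hgcd (congrFun hmod)
      (hα.dvd_sub_of_pow_eq hm0 lα)]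
  · simp only [mul_comm 3, pow_mul] at l3
    exact absurd l3.symm (BurstCode.cube_add_cube_ne (hne0 _) (hne0 _) (hne0 _) l1.symm)
  · exact absurd (CharTwo.add_eq_zero.1 l1) (hpair_ne hij hc)
  · simp only [mul_comm 3, pow_mul] at l3
    exact absurd l3 (BurstCode.cube_add_cube_ne (hne0 _) (hne0 _) (hne0 _) l1)
  -- The `β` layers match the pairs only up to order, so `i'` and `j'` are kept general and the
  -- claim is also applied with them swapped.
  · have match_pairs {i' j' : BurstCode.Pos (n * p) D} (hc' : BurstCode.IsCloseL1 b i' j')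
        (hi : β ^ BurstCode.syndromeVal A i = β ^ BurstCode.syndromeVal A i')
        (hj : β ^ BurstCode.syndromeVal A j = β ^ BurstCode.syndromeVal A j')
        (lq : ∀ t, (((i t : ℕ) / p : ℕ) : ZMod 2) + (((j t : ℕ) / p : ℕ) : ZMod 2) =
          (((i' t : ℕ) / p : ℕ) : ZMod 2) + (((j' t : ℕ) / p : ℕ) : ZMod 2))
        (lγ : (γ ^ BurstCode.baseVal p fun t => (i t : ℕ) % p) +
            (γ ^ BurstCode.baseVal p fun t => (j t : ℕ) % p) =
          (γ ^ BurstCode.baseVal p fun t => (i' t : ℕ) % p) +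
            (γ ^ BurstCode.baseVal p fun t => (j' t : ℕ) % p))
        (lα : (α ^ BurstCode.baseVal n fun t => (i t : ℕ)) +
            (α ^ BurstCode.baseVal n fun t => (j t : ℕ)) =
          (α ^ BurstCode.baseVal n fun t => (i' t : ℕ)) +
            (α ^ BurstCode.baseVal n fun t => (j' t : ℕ))) : i = i' ∧ j = j' := by
      have hdiff := BurstCode.sub_eq_sub_of_mulVec_eq hp2 hb1 hξ hA hc hc' (hsyn hi) (hsyn hj)
      have hi := BurstCode.eq_of_translate_of_layers_eq hn (by omega) hm0 ha'0 hmle ha'le hgcd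
        hα hγ hij hc hdiff lq lγ lα
      refine ⟨hi, funext fun t => Fin.ext ?_⟩
      have := hdiff t
      rw [hi] at this
      omega
    simp only [mul_comm 3, pow_mul] at l3
    rcases BurstCode.pair_eq_of_add_eq_of_cube_add_eq (hpair_ne hij hc) l1 l3 with
      ⟨hi, hj⟩ | ⟨hi, hj⟩
    · obtain ⟨rfl, rfl⟩ := match_pairs hc' hi hj (congrFun lq) lγ lα
      rfl
    · obtain ⟨rfl, rfl⟩ := match_pairs hc'.symm hi hj
        (congrFun (lq.trans (add_comm _ _))) (lγ.trans (add_comm _ _))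
        (lα.trans (add_comm _ _))
      exact add_comm _ _
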